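/- Let $V$ be a finite set of wireless nodes placed in the Euclidean plane, $d_{(u,v)}$ the distance between $u$ and $v$, and let $G=(V,E)$ be an undirected graph of links such that antennas are omni-directional: if $(u,v)\in E$, $w\neq u$ and $d_{(u,w)}\le d_{(u,v)}$, then $(u,w)\in E$ (for example, $(u,v)\in E$ iff $u\ne v$ and $d_{(u,v)}$ is at most a common maximal transmission range). Let $\alpha\ge 2$. Sending a packet over a link $(u,v)$ costs $d_{(u,v)}^\alpha$, the weight of the link; receiving a packet costs $\varepsilon_r\ge 0$, where $\varepsilon_r\le d_{(u,v)}^\alpha$ for every link. Let $M\subseteq V$ be a nonempty set of group members lying in one connected component of $G$; each $u\in M$ has to send $p(u)\in\mathbb N$ packets to all other members. A multicast tree is a subtree $T$ of $G$ with node set $\mathit{nd}(T)\supseteq M$. Let $\mathit{in}(T)$ be the set of nodes of degree more than one in $T$, let $\lambda(u,T)$ be the maximal weight of a link of $T$ at $u$ ($0$ if there is none), let $\zeta(T)$ be the sum of the weights of the links of $T$, and let the energy of a session over $T$ be $$\Psi(T)=\sum_{u\in M}p(u)\Big(\sum_{v\in \mathit{in}(T)\cup\{u\}}\lambda(v,T)+(|\mathit{nd}(T)|-1)\,\varepsilon_r\Big).$$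 MEAAM (Minimum-Energy All-to-All Multicasting) asks for a multicast tree minimizing $\Psi$. Consider the distributed Steiner tree algorithm on $M$: at the start every member forms a fragment of its own; as long as possible, two fragments that prefer each other (a path of least weight between members of the two has weight at most that of every walk from a member of either of them to a member of any other fragment) are merged, marking such a path, where the order of mergers and the breaking of ties are arbitrary; when all members are in one fragment, overlaps of the marked paths are pruned in an arbitrary way, leaving a tree that contains $M$ and consists of members and of nodes and links of marked paths. Then every execution of the algorithm terminates, with all members in one fragment and with at least one such tree; every tree $T$ that it can return is a $2$-approximate Steiner tree of $M$, i.e. $\zeta(T)\le 2\,\zeta(T')$ for every multicast tree $T'$, and satisfies $\Psi(T)\le 145\,\Psi(T')$ for every multicast tree $T'$; thus the algorithm approximates MEAAM with adjustable transmission power within the constant ratio $145$. More generally, every $2$-approximate Steiner tree $T$ of $M$ in $G$ satisfies $\Psi(T)\le 145\,\Psi(T')$ for every multicast tree $T'$. -/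

import Mathlib

namespace GroupComm

/-- The plane with its Euclidean distance. -/
abbrev Plane := EuclideanSpace ℝ (Fin 2)

section Energy

variable {V : Type*}

/-- Energy needed to send one packet from `u` directly to `v`: the `α`-th power of their
Euclidean distance. This is also the weight of the link `uv`. -/
noncomputable def linkEnergy (pos : V → Plane) (α : ℝ) (u v : V) : ℝ :=
  dist (pos u) (pos v) ^ α

lemma linkEnergy_comm (pos : V → Plane) (α : ℝ) (u v : V) :
    linkEnergy pos α u v = linkEnergy pos α v u := by
  simp only [linkEnergy, dist_comm]

/-- The weight of a link, as a function of the unordered pair of its end points. -/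
noncomputable def edgeEnergy (pos : V → Plane) (α : ℝ) : Sym2 V → ℝ :=
  Sym2.lift ⟨linkEnergy pos α, linkEnergy_comm pos α⟩

/-- Sum of the weights of the links along a walk, with multiplicity. -/
noncomputable def walkEnergy (pos : V → Plane) (α : ℝ) {G : SimpleGraph V} {u v : V}
    (w : G.Walk u v) : ℝ :=
  (w.edges.map (edgeEnergy pos α)).sum

/-- Antennas are omni-directional: if `u` can reach `v` then it can reach every node that is
not farther away than `v`. -/
def IsOmnidirectional (pos : V → Plane) (G : SimpleGraph V) : Prop :=
  ∀ u v w : V, G.Adj u v → w ≠ u → dist (pos u) (pos w) ≤ dist (pos u) (pos v) → G.Adj u w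

/-- `T` is a multicast tree for the member set `M`: a tree in `G` (possibly with further nodes)
containing all members. -/
def IsMulticastTree {G : SimpleGraph V} (M : Finset V) (T : G.Subgraph) : Prop :=
  T.coe.IsTree ∧ (M : Set V) ⊆ T.verts

/-- Transmission power of `u` in `T`: the largest weight of a link of `T` at `u`
(`0` if `u` has no neighbour in `T`). -/
noncomputable def txPower (pos : V → Plane) (α : ℝ) {G : SimpleGraph V} (T : G.Subgraph)
    (u : V) : ℝ :=
  sSup (linkEnergy pos α u '' T.neighborSet u)

/-- Internal nodes of `T`: those of degree more than one in `T`. -/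
def IsInternal {G : SimpleGraph V} (T : G.Subgraph) (v : V) : Prop :=
  1 < (T.neighborSet v).ncard

open Classical in
/-- Total weight of the links of `T`. -/
noncomputable def treeWeight [Fintype V] (pos : V → Plane) (α : ℝ) {G : SimpleGraph V}
    (T : G.Subgraph) : ℝ :=
  ∑ e : Sym2 V with e ∈ T.edgeSet, edgeEnergy pos α e

open Classical in
/-- Total energy of a session over `T`: each of the `p u` packets originating from the member `u`
is transmitted once by `u` and once by every internal node of `T`, at the transmission power of
that node in `T`, and it is received once by every node of `T` other than `u`. -/
noncomputable def sessionEnergy [Fintype V] (pos : V → Plane) (α εr : ℝ) (M : Finset V)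
    (p : V → ℕ) {G : SimpleGraph V} (T : G.Subgraph) : ℝ :=
  ∑ u ∈ M, (p u : ℝ) *
    ((∑ v : V with v ∈ T.verts ∧ (v = u ∨ IsInternal T v), txPower pos α T v)
      + ((T.verts.ncard : ℝ) - 1) * εr)

/-- `T` is a multicast tree whose total link weight is at most `c` times that of every
multicast tree, that is, a `c`-approximate Steiner tree of `M` in `G`. -/
def IsSteinerApprox [Fintype V] (pos : V → Plane) (α c : ℝ) (M : Finset V)
    {G : SimpleGraph V} (T : G.Subgraph) : Prop :=
  IsMulticastTree M T ∧
    ∀ T' : G.Subgraph, IsMulticastTree M T' → treeWeight pos α T ≤ c * treeWeight pos α T'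

/-- `T` is a multicast tree whose session energy is at most `c` times that of every multicast
tree, in particular at most `c` times the minimum. -/
def IsMEAAMApprox [Fintype V] (pos : V → Plane) (α εr c : ℝ) (M : Finset V) (p : V → ℕ)
    {G : SimpleGraph V} (T : G.Subgraph) : Prop :=
  IsMulticastTree M T ∧ ∀ T' : G.Subgraph, IsMulticastTree M T' →
    sessionEnergy pos α εr M p T ≤ c * sessionEnergy pos α εr M p T'

end Energy

section SteinerAlgorithm

variable {V : Type*}

/-- A global state of the distributed Steiner tree algorithm: the fragments into which the members
have been merged so far, and the nodes and links that have been marked. -/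
structure SteinerState (G : SimpleGraph V) where
  fragments : Set (Set V)
  marked : G.Subgraph

/-- At the start every member is a fragment of its own and no link is marked. -/
def SteinerState.init (G : SimpleGraph V) (M : Finset V) : SteinerState G where
  fragments := {A | ∃ m ∈ M, A = {m}}
  marked :=
    { verts := (M : Set V)
      Adj := fun _ _ => False
      adj_sub := fun h => h.elim
      edge_vert := fun h => h.elim
      symm := ⟨fun _ _ h => h.elim⟩ }

/-- The walk `w` has least energy among all walks from a member in fragment `A` to a member in
another fragment, so that a connection along `w` is one that `A` prefers. -/
def IsPreferred (pos : V → Plane) (α : ℝ) {G : SimpleGraph V} (s : SteinerState G) (A : Set V)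
    {a b : V} (w : G.Walk a b) : Prop :=
  ∀ C ∈ s.fragments, C ≠ A → ∀ x ∈ A, ∀ y ∈ C, ∀ q : G.Walk x y,
    walkEnergy pos α w ≤ walkEnergy pos α q

/-- One accepted connection request: two fragments that prefer each other, through the same path,
mark this path and merge. Any mutually preferring pair may act (asynchrony), and ties may be
broken in any way. -/
def SteinerStep (pos : V → Plane) (α : ℝ) {G : SimpleGraph V} (s t : SteinerState G) : Prop :=
  ∃ A ∈ s.fragments, ∃ B ∈ s.fragments, A ≠ B ∧
    ∃ a ∈ A, ∃ b ∈ B, ∃ w : G.Walk a b, w.IsPath ∧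
      IsPreferred pos α s A w ∧ IsPreferred pos α s B w ∧
      t.fragments = (s.fragments \ {A, B}) ∪ {A ∪ B} ∧
      t.marked = s.marked ⊔ w.toSubgraph

/-- `s` can occur in an execution of the algorithm. -/
def SteinerReachable (pos : V → Plane) (α : ℝ) {G : SimpleGraph V} (M : Finset V)
    (s : SteinerState G) : Prop :=
  Relation.ReflTransGen (SteinerStep pos α) (SteinerState.init G M) s

/-- All members have been merged into one fragment. -/
def SteinerState.IsFinal {G : SimpleGraph V} (M : Finset V) (s : SteinerState G) : Prop :=
  s.fragments = {(M : Set V)}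

/-- `T` is a possible result of the algorithm from the state `s`: the execution has ended in `s`,
and `T` is a tree containing `M` that remains of the marked nodes and links after superfluous ones
(where marked paths overlap) have been pruned, in any way. -/
def SteinerState.IsOutput {G : SimpleGraph V} (M : Finset V) (s : SteinerState G)
    (T : G.Subgraph) : Prop :=
  s.IsFinal M ∧ T ≤ s.marked ∧ IsMulticastTree M T

end SteinerAlgorithm

end GroupComm

open GroupComm

/-!
Both halves of the theorem are elementary: an exchange argument for the Steiner tree algorithm, and
a planar estimate that relates the weight of a tree to the power of the nodes that transmit in it.

**The algorithm.** Each step lowers the number of fragments by one, so every execution stops. While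
two fragments are left, a lightest path between members of different fragments is preferred by both
of its fragments, so the execution has not stopped. For the approximation ratio, let `T'` be any
multicast tree. A closed walk around `T'` spends twice its weight; joining consecutive members on
the walk gives a connected graph on `M`, weighed by path energies, of total weight at most
`2 * treeWeight T'`. When two fragments `A` and `B` merge along a path, some edge of that graph
leaves `A` and closes a cycle with the path, hence is no longer needed; it weighs at least as much
as the path, because `A` prefers the path. So the marked links together with the remaining edges
never weigh more than `2 * treeWeight T'` (`exists_completion`).

**Session energy.** Per packet, a tree `T` spends at most three times its weight: a link is the
strongest one of at most two nodes, and each of the `n - 1` receptions costs at most one link. If `T`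
is a `2`-approximate Steiner tree this is at most six times the weight of any multicast tree. It
remains to find, for any multicast tree `T'` and any sender `u`, a multicast tree of weight at most
`47 / 2` times the power spent by the senders `in(T') ∪ {u}`; the ratio is then `6 * 47 / 2 = 141`.

To this end the links from a sender `v` of power `r ^ α` to its neighbours in `T'` are replaced by
a light connected graph (`exists_graph_of_txPower`). The neighbours lie in a disc of radius `r`,
which fits into an isosceles right triangle with legs `7 / 2 * r`. Points in such a triangle can be
visited on a tour between its acute corners with squared step lengths adding up to at most the
squared hypotenuse `49 / 2 * r ^ 2` (`exists_tour_triangle`). The step from the first corner is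
traded for a link from `v`, the step to the second corner, of length at least `r`, is dropped, and
steps longer than the links from `v` to their end points are replaced by such a link
(`exists_graph_of_tour`); what remains are links of `G`, as antennas are omni-directional. Since all
of them have length at most `r` and `α ≥ 2`, squares can be turned into `α`-th powers. Every link of
`T'` is at a sender, so the union of these graphs joins all nodes of `T'` and contains the required
tree.
-/

namespace GroupComm

/-! ### Sums over the edges of a graph -/

section EdgeSum

variable {V : Type*} [Fintype V]

open Classical in
/-- The edges of `K` as a finite set. -/
noncomputable def edges (K : SimpleGraph V) : Finset (Sym2 V) :=
  {e | e ∈ K.edgeSet}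

@[simp] lemma mem_edges {K : SimpleGraph V} {e : Sym2 V} : e ∈ edges K ↔ e ∈ K.edgeSet := by
  simp [edges]

/-- Sum of `f` over the edges of `K`. Links of subgraphs of `G`, and auxiliary graphs on `V`, are
all weighed by means of this sum. -/
noncomputable def edgeSum (f : Sym2 V → ℝ) (K : SimpleGraph V) : ℝ :=
  ∑ e ∈ edges K, f e

variable {f : Sym2 V → ℝ}

lemma edgeSum_nonneg (hf : ∀ e, 0 ≤ f e) (K : SimpleGraph V) : 0 ≤ edgeSum f K :=
  Finset.sum_nonneg fun e _ => hf e

lemma edgeSum_mono (hf : ∀ e, 0 ≤ f e) {K L : SimpleGraph V} (h : K ≤ L) :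
    edgeSum f K ≤ edgeSum f L := by
  refine Finset.sum_le_sum_of_subset_of_nonneg (fun e he => ?_) fun e _ _ => hf e
  rw [mem_edges] at he ⊢
  exact SimpleGraph.edgeSet_mono h he

lemma edgeSum_bot : edgeSum f (⊥ : SimpleGraph V) = 0 := by
  refine Finset.sum_eq_zero fun e he => ?_
  simp at he

lemma edgeSum_sup_le (hf : ∀ e, 0 ≤ f e) (K L : SimpleGraph V) :
    edgeSum f (K ⊔ L) ≤ edgeSum f K + edgeSum f L := by
  classical
  have hsub : edges (K ⊔ L) ⊆ edges K ∪ edges L := by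
    intro e
    simp [SimpleGraph.edgeSet_sup]
  have h1 := Finset.sum_le_sum_of_subset_of_nonneg hsub fun e _ _ => hf e
  have h2 := Finset.sum_union_inter (f := f) (s₁ := edges K) (s₂ := edges L)
  have h3 : 0 ≤ ∑ e ∈ edges K ∩ edges L, f e := Finset.sum_nonneg fun e _ => hf e
  unfold edgeSum
  linarith

lemma edgeSum_edge_le (hf : ∀ e, 0 ≤ f e) (u v : V) :
    edgeSum f (SimpleGraph.edge u v) ≤ f s(u, v) := by
  have hsub : edges (SimpleGraph.edge u v) ⊆ {s(u, v)} := by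
    intro e
    simp only [SimpleGraph.edge, SimpleGraph.edgeSet_fromEdgeSet, mem_edges,
      Finset.mem_singleton]
    exact fun h => h.1
  simpa [edgeSum] using Finset.sum_le_sum_of_subset_of_nonneg hsub fun e _ _ => hf e

lemma edgeSum_deleteEdges_add {K : SimpleGraph V} {e : Sym2 V} (he : e ∈ K.edgeSet) :
    edgeSum f (K.deleteEdges {e}) + f e = edgeSum f K := by
  classical
  have : edges (K.deleteEdges {e}) = (edges K).erase e := by
    ext e'
    simp [SimpleGraph.edgeSet_deleteEdges, and_comm]
  unfold edgeSum
  rw [this, Finset.sum_erase_add]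
  simpa using he

lemma edgeSum_finset_sup_le {ι : Type*} (hf : ∀ e, 0 ≤ f e) (s : Finset ι) (K : ι → SimpleGraph V) :
    edgeSum f (s.sup K) ≤ ∑ i ∈ s, edgeSum f (K i) := by
  classical
  induction s using Finset.induction_on with
  | empty => simp [edgeSum_bot]
  | insert i s hi ih =>
    rw [Finset.sup_insert, Finset.sum_insert hi]
    exact (edgeSum_sup_le hf _ _).trans (by gcongr)

end EdgeSum

section Weights

variable {V : Type*} {pos : V → Plane} {α : ℝ} {G : SimpleGraph V}

lemma linkEnergy_nonneg (u v : V) : 0 ≤ linkEnergy pos α u v :=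
  Real.rpow_nonneg dist_nonneg _

lemma edgeEnergy_nonneg (e : Sym2 V) : 0 ≤ edgeEnergy pos α e := by
  induction e with
  | _ u v => exact linkEnergy_nonneg u v

lemma edgeEnergy_mk (u v : V) : edgeEnergy pos α s(u, v) = linkEnergy pos α u v := rfl

lemma walkEnergy_nonneg {u v : V} (w : G.Walk u v) : 0 ≤ walkEnergy pos α w := by
  refine List.sum_nonneg fun x hx => ?_
  obtain ⟨e, -, rfl⟩ := List.mem_map.1 hx
  exact edgeEnergy_nonneg e

@[simp] lemma walkEnergy_nil (u : V) : walkEnergy pos α (.nil : G.Walk u u) = 0 := by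
  simp [walkEnergy]

@[simp] lemma walkEnergy_cons {u v w : V} (h : G.Adj u v) (p : G.Walk v w) :
    walkEnergy pos α (.cons h p) = linkEnergy pos α u v + walkEnergy pos α p := by
  simp [walkEnergy, edgeEnergy_mk]

@[simp] lemma walkEnergy_append {u v w : V} (p : G.Walk u v) (q : G.Walk v w) :
    walkEnergy pos α (p.append q) = walkEnergy pos α p + walkEnergy pos α q := by
  simp [walkEnergy]

@[simp] lemma walkEnergy_reverse {u v : V} (p : G.Walk u v) :
    walkEnergy pos α p.reverse = walkEnergy pos α p := by
  simp [walkEnergy]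

lemma walkEnergy_bypass_le [DecidableEq V] {u v : V} (p : G.Walk u v) :
    walkEnergy pos α p.bypass ≤ walkEnergy pos α p := by
  refine (p.edges_bypass_sublist_edges.map _).sum_le_sum fun x hx => ?_
  obtain ⟨e, -, rfl⟩ := List.mem_map.1 hx
  exact edgeEnergy_nonneg e

lemma treeWeight_eq_edgeSum [Fintype V] (T : G.Subgraph) :
    treeWeight pos α T = edgeSum (edgeEnergy pos α) T.spanningCoe := by
  classical
  exact Finset.sum_congr (by ext e; simp) fun _ _ => rfl

lemma edgeSum_toSubgraph_le [Fintype V] {u v : V} (w : G.Walk u v) :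
    edgeSum (edgeEnergy pos α) w.toSubgraph.spanningCoe ≤ walkEnergy pos α w := by
  induction w with
  | @nil x =>
    have : (G.singletonSubgraph x).spanningCoe = ⊥ := by ext; simp
    simp [SimpleGraph.Walk.toSubgraph, this, edgeSum_bot]
  | @cons x y z h p ih =>
    have hle : (SimpleGraph.Walk.cons h p).toSubgraph.spanningCoe ≤
        SimpleGraph.edge x y ⊔ p.toSubgraph.spanningCoe := by
      intro a b hab
      simp only [SimpleGraph.Walk.toSubgraph, SimpleGraph.Subgraph.spanningCoe_adj,
        SimpleGraph.Subgraph.sup_adj, SimpleGraph.subgraphOfAdj_adj] at hab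
      simp only [SimpleGraph.sup_adj, SimpleGraph.Subgraph.spanningCoe_adj]
      rcases hab with hab | hab
      · left
        have := h.ne
        rw [SimpleGraph.edge_adj]
        simp only [Sym2.eq_iff] at hab
        grind
      · exact Or.inr hab
    rw [walkEnergy_cons, ← edgeEnergy_mk]
    have h1 := edgeSum_mono (edgeEnergy_nonneg (pos := pos) (α := α)) hle
    have h2 := edgeSum_sup_le (edgeEnergy_nonneg (pos := pos) (α := α)) (SimpleGraph.edge x y)
      p.toSubgraph.spanningCoe
    have h3 := edgeSum_edge_le (edgeEnergy_nonneg (pos := pos) (α := α)) x y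
    linarith

end Weights

/-! ### Multicast trees inside connected graphs -/

section SpanningTree

variable {V : Type*} {G : SimpleGraph V}

/-- If a graph `K` of links joins all members, then a component of a spanning forest of `K` is a
multicast tree. Its nodes are restricted to those `K` joins to a member. -/
lemma exists_multicastTree_le {M : Finset V} {K : SimpleGraph V} (hK : K ≤ G) {c : V}
    (hconn : ∀ x ∈ M, K.Reachable c x) :
    ∃ T : G.Subgraph, IsMulticastTree M T ∧ T.spanningCoe ≤ K ∧
      ∀ x ∈ T.verts, K.Reachable c x := by
  obtain ⟨F, hFK, hF, hreach⟩ := K.exists_isAcyclic_reachable_eq_le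
  let C := F.connectedComponentMk c
  let T : G.Subgraph :=
    { verts := C.supp
      Adj := fun x y => F.Adj x y ∧ x ∈ C.supp
      adj_sub := fun h => hK (hFK h.1)
      edge_vert := fun h => h.2
      symm := ⟨fun x y h => ⟨h.1.symm, (C.mem_supp_congr_adj h.1).1 h.2⟩⟩ }
  have hmem : ∀ x, x ∈ C.supp ↔ K.Reachable c x := by
    intro x
    rw [SimpleGraph.ConnectedComponent.mem_supp_iff, SimpleGraph.ConnectedComponent.eq, hreach]
    exact SimpleGraph.reachable_comm
  refine ⟨T, ⟨?_, fun x hx => (hmem x).2 (hconn x hx)⟩, fun x y h => hFK h.1, fun x hx =>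
    (hmem x).1 hx⟩
  have hiso : T.coe ≃g C.toSimpleGraph :=
    { toEquiv := Equiv.refl _
      map_rel_iff' := fun {x y} => ⟨fun h => ⟨h, x.2⟩, fun h => h.1⟩ }
  exact hiso.isTree_iff.2 (hF.isTree_connectedComponent C)

lemma reachable_of_forall_adj {H L : SimpleGraph V} (h : ∀ x y, H.Adj x y → L.Reachable x y)
    {x y : V} (hxy : H.Reachable x y) : L.Reachable x y := by
  obtain ⟨p⟩ := hxy
  induction p with
  | nil => rfl
  | cons hadj _ ih => exact (h _ _ hadj).trans ih

/-- In a connected subgraph any two nodes are joined by its own links. -/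
lemma spanningCoe_reachable {H : G.Subgraph} (hH : H.coe.Connected) {x y : V} (hx : x ∈ H.verts)
    (hy : y ∈ H.verts) : H.spanningCoe.Reachable x y := by
  have h := (hH.preconnected ⟨x, hx⟩ ⟨y, hy⟩)
  exact h.map (⟨Subtype.val, fun {a b} hab => hab⟩ : H.coe →g H.spanningCoe)

end SpanningTree

/-! ### Short tours of point sets in the plane -/

section Tour

variable {V E : Type*}

/-- Sum of the squared step lengths of the polygonal path from `A` through the nodes of the list,
in this order, to `B`. -/
noncomputable def tourSq [Dist E] (pos : V → E) : E → List V → E → ℝ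
  | A, [], B => dist A B ^ 2
  | A, x :: l, B => dist A (pos x) ^ 2 + tourSq pos (pos x) l B

lemma tourSq_eq_of_forall_eq [MetricSpace E] {p B : E} (l : List V) (h : ∀ x ∈ l, pos x = p) :
    tourSq pos p l B = dist p B ^ 2 := by
  induction l with
  | nil => rfl
  | cons x l ih =>
    rw [tourSq, h x (by simp), ih fun y hy => h y (by simp [hy])]
    simp

lemma exists_pos_le_dist [Finite V] [MetricSpace E] (pos : V → E) :
    ∃ δ > 0, ∀ x y, pos x ≠ pos y → δ ≤ dist (pos x) (pos y) := by
  let S : Set (V × V) := {q | pos q.1 ≠ pos q.2}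
  rcases S.eq_empty_or_nonempty with hS | hS
  · refine ⟨1, one_pos, fun x y h => ?_⟩
    have : (x, y) ∈ S := h
    simp [hS] at this
  · obtain ⟨q, hq, hmin⟩ := Set.exists_min_image S (fun q => dist (pos q.1) (pos q.2))
      S.toFinite hS
    exact ⟨dist (pos q.1) (pos q.2), dist_pos.2 hq, fun x y h => hmin (x, y) h⟩

variable [NormedAddCommGroup E] [InnerProductSpace ℝ E]

lemma dist_sq_le_of_inner_nonneg {C p q : E} (h : 0 ≤ inner ℝ (p - C) (q - C)) :
    dist p q ^ 2 ≤ dist p C ^ 2 + dist C q ^ 2 := by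
  rw [dist_eq_norm, dist_eq_norm, dist_comm C q, dist_eq_norm,
    show p - q = (p - C) - (q - C) by abel, norm_sub_sq_real]
  linarith

/-- A corner `C` can be cut off when two tours are joined there, provided that all their points
lie within a right angle as seen from `C`. -/
lemma tourSq_append_le {pos : V → E} {C : E} {P : Set E}
    (hP : ∀ p ∈ P, ∀ q ∈ P, 0 ≤ inner ℝ (p - C) (q - C)) {B : E} (hB : B ∈ P) {l₂ : List V}
    (h₂ : ∀ x ∈ l₂, pos x ∈ P) (l₁ : List V) (h₁ : ∀ x ∈ l₁, pos x ∈ P) {A : E} (hA : A ∈ P) :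
    tourSq pos A (l₁ ++ l₂) B ≤ tourSq pos A l₁ C + tourSq pos C l₂ B := by
  induction l₁ generalizing A with
  | nil =>
    cases l₂ with
    | nil => exact dist_sq_le_of_inner_nonneg (hP A hA B hB)
    | cons y l =>
      have := dist_sq_le_of_inner_nonneg (hP A hA (pos y) (h₂ y (by simp)))
      simp only [List.nil_append, tourSq]
      linarith
  | cons x l₁ ih =>
    have := ih (fun y hy => h₁ y (by simp [hy])) (h₁ x (by simp))
    simp only [List.cons_append, tourSq]
    linarith

lemma norm_sq_comb {a b : E} (hab : inner ℝ a b = 0) (hn : ‖a‖ = ‖b‖) (s t : ℝ) :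
    ‖s • a + t • b‖ ^ 2 = (s ^ 2 + t ^ 2) * ‖a‖ ^ 2 := by
  rw [norm_add_sq_real, norm_smul, norm_smul, real_inner_smul_left, real_inner_smul_right, hab,
    ← hn, mul_pow, mul_pow, Real.norm_eq_abs, Real.norm_eq_abs, sq_abs, sq_abs]
  ring

lemma inner_comb {a b : E} (hab : inner ℝ a b = 0) (hn : ‖a‖ = ‖b‖) (s t s' t' : ℝ) :
    inner ℝ (s • a + t • b) (s' • a + t' • b) = (s * s' + t * t') * ‖a‖ ^ 2 := by
  have hba : inner ℝ b a = 0 := by rw [real_inner_comm, hab]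
  simp only [inner_add_left, inner_add_right, real_inner_smul_left, real_inner_smul_right, hab,
    hba, real_inner_self_eq_norm_sq, ← hn]
  ring

/-- Points in an isosceles right triangle with right angle at `C` and legs `a`, `b` can be visited
on a tour from one acute corner to the other whose squared step lengths add up to at most the
square of the hypotenuse. The triangle is halved along its altitude; the tours of the two halves
meet in `C`, where they are joined. The recursion stops once all points of a triangle coincide,
as they do when its hypotenuse is below the least distance `δ` between different positions. -/
lemma exists_tour_triangle {pos : V → E} {δ : ℝ}
    (hδ : ∀ x y, pos x ≠ pos y → δ ≤ dist (pos x) (pos y)) (hδ0 : 0 < δ) (n : ℕ) :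
    ∀ (C a b : E), inner ℝ a b = 0 → ‖a‖ = ‖b‖ → 2 * ‖a‖ ^ 2 < 2 ^ n * δ ^ 2 → ∀ L : List V,
      (∀ x ∈ L, ∃ s t : ℝ, 0 ≤ s ∧ 0 ≤ t ∧ s + t ≤ 1 ∧ pos x = C + (s • a + t • b)) →
      ∃ l : List V, (∀ x, x ∈ l ↔ x ∈ L) ∧ tourSq pos (C + a) l (C + b) ≤ 2 * ‖a‖ ^ 2 := by
  classical
  induction n with
  | zero =>
    intro C a b hab hn hlt L hL
    refine ⟨L, fun x => Iff.rfl, ?_⟩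
    have hsq : 0 ≤ ‖a‖ ^ 2 := sq_nonneg _
    cases L with
    | nil =>
      rw [tourSq, dist_eq_norm, show C + a - (C + b) = (1 : ℝ) • a + (-1 : ℝ) • b by module,
        norm_sq_comb hab hn]
      linarith
    | cons x L =>
      obtain ⟨s, t, hs, ht, hst, hx⟩ := hL x (by simp)
      have heq : ∀ y ∈ L, pos y = pos x := by
        intro y hy
        by_contra hne
        obtain ⟨s', t', hs', ht', hst', hy'⟩ := hL y (by simp [hy])
        have h1 := hδ y x hne
        have h2 : dist (pos y) (pos x) ^ 2 = ((s' - s) ^ 2 + (t' - t) ^ 2) * ‖a‖ ^ 2 := by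
          rw [← norm_sq_comb hab hn, dist_eq_norm, hx, hy']
          congr 2
          module
        have h3 : (s' - s) ^ 2 + (t' - t) ^ 2 ≤ 2 := by nlinarith
        have h4 : δ ^ 2 ≤ dist (pos y) (pos x) ^ 2 := by gcongr
        have h5 : ((s' - s) ^ 2 + (t' - t) ^ 2) * ‖a‖ ^ 2 ≤ 2 * ‖a‖ ^ 2 := by gcongr
        linarith
      rw [tourSq, tourSq_eq_of_forall_eq L heq, dist_eq_norm, dist_eq_norm, hx,
        show C + a - (C + (s • a + t • b)) = (1 - s) • a + (-t) • b by module,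
        show C + (s • a + t • b) - (C + b) = s • a + (t - 1) • b by module,
        norm_sq_comb hab hn, norm_sq_comb hab hn, ← add_mul]
      gcongr
      nlinarith
  | succ n ih =>
    intro C a b hab hn hlt L hL
    choose! s t hs ht hst hx using hL
    have half : ∀ a' : E, ‖a'‖ ^ 2 = ‖a‖ ^ 2 / 2 → 2 * ‖a'‖ ^ 2 < 2 ^ n * δ ^ 2 := by
      intro a' h
      rw [h]
      have := pow_succ (2 : ℝ) n
      rw [this] at hlt
      linarith
    set u : E := (1 / 2 : ℝ) • a + (-1 / 2 : ℝ) • b with hu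
    set w : E := (-1 / 2 : ℝ) • a + (-1 / 2 : ℝ) • b with hw
    set D : E := C + ((1 / 2 : ℝ) • a + (1 / 2 : ℝ) • b) with hD
    have huw : inner ℝ u w = 0 := by rw [inner_comb hab hn]; ring
    have hu2 : ‖u‖ ^ 2 = ‖a‖ ^ 2 / 2 := by rw [norm_sq_comb hab hn]; ring
    have hw2 : ‖w‖ ^ 2 = ‖a‖ ^ 2 / 2 := by rw [norm_sq_comb hab hn]; ring
    have hnorm : ‖u‖ = ‖w‖ := by
      rw [← sq_eq_sq₀ (norm_nonneg _) (norm_nonneg _), hu2, hw2]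
    obtain ⟨l₁, hl₁, ht₁⟩ := ih D u w huw hnorm (half u hu2) (L.filter fun x => t x ≤ s x) (by
      intro x hxL
      simp only [List.mem_filter, decide_eq_true_eq] at hxL
      obtain ⟨hxL, hle⟩ := hxL
      refine ⟨s x - t x, 1 - s x - t x, by linarith, by linarith [hst x hxL],
        by linarith [ht x hxL], ?_⟩
      rw [hx x hxL]
      module)
    obtain ⟨l₂, hl₂, ht₂⟩ := ih D w (-u) (by rw [inner_neg_right, real_inner_comm, huw, neg_zero])
      (by rw [norm_neg, hnorm]) (half w hw2) (L.filter fun x => ¬ t x ≤ s x) (by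
      intro x hxL
      simp only [List.mem_filter, decide_eq_true_eq] at hxL
      obtain ⟨hxL, hle⟩ := hxL
      refine ⟨1 - s x - t x, t x - s x, by linarith [hst x hxL], by linarith,
        by linarith [hs x hxL], ?_⟩
      rw [hx x hxL]
      module)
    rw [show D + u = C + a by module, show D + w = C by module] at ht₁
    rw [show D + w = C by module, show D + -u = C + b by module] at ht₂
    refine ⟨l₁ ++ l₂, fun x => ?_, ?_⟩
    · rw [List.mem_append, hl₁, hl₂]
      simp only [List.mem_filter, decide_eq_true_eq]
      tauto
    · let P : Set E := {p | ∃ s t : ℝ, 0 ≤ s ∧ 0 ≤ t ∧ p = C + (s • a + t • b)}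
      have hP : ∀ p ∈ P, ∀ q ∈ P, 0 ≤ inner ℝ (p - C) (q - C) := by
        rintro p ⟨s, t, hs, ht, rfl⟩ q ⟨s', t', hs', ht', rfl⟩
        rw [add_sub_cancel_left, add_sub_cancel_left, inner_comb hab hn]
        positivity
      have hLP : ∀ x ∈ L, pos x ∈ P := fun x h => ⟨s x, t x, hs x h, ht x h, hx x h⟩
      have := tourSq_append_le hP (B := C + b) ⟨0, 1, le_rfl, zero_le_one, by module⟩
        (fun x h => hLP x (List.mem_filter.1 ((hl₂ x).1 h)).1) l₁
        (fun x h => hLP x (List.mem_filter.1 ((hl₁ x).1 h)).1) (A := C + a)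
        ⟨1, 0, zero_le_one, le_rfl, by module⟩
      linarith

end Tour

/-- Nodes within distance `r` of a centre `c` can be ordered as a tour between two far points `A`,
`B` with squared step lengths adding up to at most `49 / 2 * r ^ 2`: the disc lies in an isosceles
right triangle with legs `7 / 2 * r`. -/
lemma exists_tour_disc {V : Type*} [Finite V] (pos : V → Plane) (c : Plane) {r : ℝ} (L : List V)
    (hL : ∀ x ∈ L, dist c (pos x) ≤ r) (hr : 0 ≤ r) :
    ∃ (l : List V) (A B : Plane), (∀ x, x ∈ l ↔ x ∈ L) ∧ (∀ x ∈ L, r ≤ dist A (pos x)) ∧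
      (∀ x ∈ L, r ≤ dist (pos x) B) ∧ tourSq pos A l B ≤ 49 / 2 * r ^ 2 := by
  obtain ⟨δ, hδ0, hδ⟩ := exists_pos_le_dist pos
  set a : Plane := !₂[7 / 2 * r, 0] with ha
  set b : Plane := !₂[0, 7 / 2 * r] with hb
  set C : Plane := c + !₂[-r, -r] with hC
  have hab : inner ℝ a b = 0 := by simp [ha, hb, PiLp.inner_apply]
  have hna : ‖a‖ ^ 2 = 49 / 4 * r ^ 2 := by
    rw [EuclideanSpace.norm_sq_eq]
    simp [ha]
    ring
  have hnb : ‖b‖ ^ 2 = 49 / 4 * r ^ 2 := by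
    rw [EuclideanSpace.norm_sq_eq]
    simp [hb]
    ring
  have hn : ‖a‖ = ‖b‖ := by rw [← sq_eq_sq₀ (norm_nonneg _) (norm_nonneg _), hna, hnb]
  have hdist : ∀ x ∈ L, (c 0 - pos x 0) ^ 2 + (c 1 - pos x 1) ^ 2 ≤ r ^ 2 := by
    intro x hx
    have h1 : dist c (pos x) ^ 2 ≤ r ^ 2 := by gcongr; exact hL x hx
    simpa [EuclideanSpace.dist_sq_eq, Real.dist_eq, Fin.sum_univ_two] using h1
  obtain ⟨n, hn'⟩ := pow_unbounded_of_one_lt (2 * ‖a‖ ^ 2 / δ ^ 2) (one_lt_two (α := ℝ))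
  obtain ⟨l, hl, htour⟩ := exists_tour_triangle hδ hδ0 n C a b hab hn
    ((div_lt_iff₀ (by positivity)).1 hn') L (by
      intro x hx
      have hd := hdist x hx
      have h0 : |c 0 - pos x 0| ≤ r := abs_le_of_sq_le_sq (by nlinarith) hr
      have h1 : |c 1 - pos x 1| ≤ r := abs_le_of_sq_le_sq (by nlinarith) hr
      have h2 : |(c 0 - pos x 0) + (c 1 - pos x 1)| ≤ 3 / 2 * r :=
        abs_le_of_sq_le_sq (by nlinarith [sq_nonneg ((c 0 - pos x 0) - (c 1 - pos x 1))])
          (by positivity)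
      rw [abs_le] at h0 h1 h2
      rcases hr.eq_or_lt with rfl | hr0
      · refine ⟨0, 0, le_rfl, le_rfl, by norm_num, ?_⟩
        ext i
        fin_cases i <;> simp [hC] <;> linarith
      · have h72 : 0 < 7 / 2 * r := by positivity
        refine ⟨(pos x 0 - c 0 + r) / (7 / 2 * r), (pos x 1 - c 1 + r) / (7 / 2 * r),
          div_nonneg (by linarith) h72.le, div_nonneg (by linarith) h72.le, ?_, ?_⟩
        · rw [← add_div, div_le_one h72]
          linarith
        · ext i
          fin_cases i <;> simp [hC, ha, hb] <;> field_simp <;> ring)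
  have hfar : ∀ x ∈ L, r ≤ dist (C + a) (pos x) ∧ r ≤ dist (pos x) (C + b) := by
    intro x hx
    have hd := hdist x hx
    have h0 : |c 0 - pos x 0| ≤ r := abs_le_of_sq_le_sq (by nlinarith) hr
    have h1 : |c 1 - pos x 1| ≤ r := abs_le_of_sq_le_sq (by nlinarith) hr
    rw [abs_le] at h0 h1
    constructor <;> refine le_of_sq_le_sq ?_ dist_nonneg
    · simp [EuclideanSpace.dist_sq_eq, Real.dist_eq, Fin.sum_univ_two, hC, ha]
      nlinarith [sq_nonneg (c 1 + -r - pos x 1)]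
    · simp [EuclideanSpace.dist_sq_eq, Real.dist_eq, Fin.sum_univ_two, hC, hb]
      nlinarith [sq_nonneg (pos x 0 - (c 0 + -r))]
  refine ⟨l, C + a, C + b, hl, fun x hx => (hfar x hx).1, fun x hx => (hfar x hx).2, ?_⟩
  rw [hna] at htour
  linarith

/-! ### Replacing the links of a node by a light connected graph -/

lemma rpow_eq_mul_sq {d α : ℝ} (hd : 0 ≤ d) (hα : 2 ≤ α) : d ^ α = d ^ (α - 2) * d ^ 2 := by
  have h := Real.rpow_add' hd (y := α - 2) (z := 2) (by linarith)
  rwa [sub_add_cancel, Real.rpow_two] at h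

lemma rpow_le_mul_sq {d r α : ℝ} (hd : 0 ≤ d) (hdr : d ≤ r) (hα : 2 ≤ α) :
    d ^ α ≤ r ^ (α - 2) * d ^ 2 := by
  rw [rpow_eq_mul_sq hd hα]
  gcongr

lemma txPower_nonneg {V : Type*} {pos : V → Plane} {G : SimpleGraph V} {α : ℝ}
    (T : G.Subgraph) (v : V) : 0 ≤ txPower pos α T v :=
  Real.sSup_nonneg fun _ ⟨x, _, hx⟩ => hx ▸ linkEnergy_nonneg v x

section Star

variable {V : Type*} [Fintype V] {pos : V → Plane} {G : SimpleGraph V} {α : ℝ}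

/-- A node `c` is added to the interior nodes of a tour by replacing every step that is longer than
both distances to `c`: its end point is linked to `c` directly. The remaining steps are links of
`G` because antennas are omni-directional. The last step, to `B`, is dropped. -/
lemma exists_graph_of_tour (hG : IsOmnidirectional pos G) (hα : 2 ≤ α) {c : V} {r : ℝ} {N : Set V}
    (hN : ∀ x ∈ N, G.Adj c x ∧ dist (pos c) (pos x) ≤ r) {B : Plane}
    (hB : ∀ x ∈ N, r ≤ dist (pos x) B) (hr : 0 ≤ r) (l : List V) :
    ∀ y ∈ N, (∀ x ∈ l, x ∈ N) → ∃ K ≤ G,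
      (∀ K', K ≤ K' → K'.Reachable c y → ∀ x ∈ l, K'.Reachable c x) ∧
      edgeSum (edgeEnergy pos α) K + r ^ α ≤ r ^ (α - 2) * tourSq pos (pos y) l B := by
  have hr2 : 0 ≤ r ^ (α - 2) := Real.rpow_nonneg hr _
  induction l with
  | nil =>
    intro y hy _
    refine ⟨⊥, bot_le, by simp, ?_⟩
    rw [edgeSum_bot, zero_add, tourSq, rpow_eq_mul_sq hr hα]
    gcongr
    exact hB y hy
  | cons z l ih =>
    intro y hy hl
    obtain ⟨hyc, hyr⟩ := hN y hy
    have hz := hl z (by simp)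
    obtain ⟨hzc, hzr⟩ := hN z hz
    obtain ⟨K, hKG, hK, hKw⟩ := ih z hz fun x hx => hl x (by simp [hx])
    -- it suffices to join `z` to `c` or `y` by one link no longer than the step from `y` to `z`
    suffices h : y = z ∨ ∃ q, (q = y ∨ q = c) ∧ G.Adj q z ∧ dist (pos q) (pos z) ≤ r ∧
        dist (pos q) (pos z) ≤ dist (pos y) (pos z) by
      rcases h with rfl | ⟨q, hq, hadj, hqr, hqd⟩
      · refine ⟨K, hKG, fun K' hK' hy' x hx => ?_, by simpa [tourSq] using hKw⟩
        rcases List.mem_cons.1 hx with rfl | hx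
        · exact hy'
        · exact hK K' hK' hy' x hx
      · refine ⟨SimpleGraph.edge q z ⊔ K, sup_le ?_ hKG, fun K' hK' hy' x hx => ?_, ?_⟩
        · rwa [SimpleGraph.edge_le_iff, or_iff_right hadj.ne]
        · have hqz : K'.Adj q z :=
            hK' (Or.inl (by rw [SimpleGraph.edge_adj]; exact ⟨Or.inl ⟨rfl, rfl⟩, hadj.ne⟩))
          have hcz : K'.Reachable c z := by
            rcases hq with rfl | rfl
            · exact hy'.trans hqz.reachable
            · exact hqz.reachable
          rcases List.mem_cons.1 hx with rfl | hx
          · exact hcz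
          · exact hK K' (le_sup_right.trans hK') hcz x hx
        · have h1 := edgeSum_sup_le (edgeEnergy_nonneg (pos := pos) (α := α))
            (SimpleGraph.edge q z) K
          have h2 := edgeSum_edge_le (edgeEnergy_nonneg (pos := pos) (α := α)) q z
          have h3 := rpow_le_mul_sq dist_nonneg hqr hα
          have h4 : r ^ (α - 2) * dist (pos q) (pos z) ^ 2 ≤
              r ^ (α - 2) * dist (pos y) (pos z) ^ 2 := by gcongr
          rw [edgeEnergy_mk, linkEnergy] at h2
          rw [tourSq, mul_add]
          linarith
    by_cases hyz : y = z
    · exact Or.inl hyz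
    right
    by_cases h1 : dist (pos y) (pos z) ≤ dist (pos c) (pos y)
    · refine ⟨y, Or.inl rfl, hG y c z hyc.symm (Ne.symm hyz) ?_, h1.trans hyr, le_rfl⟩
      rwa [dist_comm (pos y) (pos c)]
    by_cases h2 : dist (pos y) (pos z) ≤ dist (pos c) (pos z)
    · refine ⟨y, Or.inl rfl, (hG z c y hzc.symm hyz ?_).symm, h2.trans hzr, le_rfl⟩
      rwa [dist_comm (pos z), dist_comm (pos z)]
    · exact ⟨c, Or.inr rfl, hzc, hzr, (not_le.1 h2).le⟩

/-- Any set of neighbours of `c` in `G`, within distance `r`, can be joined to `c` in `G` by links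
of total weight at most `47 / 2 * r ^ α`. -/
lemma exists_graph_of_neighbors (hG : IsOmnidirectional pos G) (hα : 2 ≤ α) {c : V} {r : ℝ}
    (hr : 0 ≤ r) {N : Set V} (hN : ∀ x ∈ N, G.Adj c x ∧ dist (pos c) (pos x) ≤ r) :
    ∃ K ≤ G, (∀ x ∈ N, K.Reachable c x) ∧ edgeSum (edgeEnergy pos α) K ≤ 47 / 2 * r ^ α := by
  have hr2 : 0 ≤ r ^ (α - 2) := Real.rpow_nonneg hr _
  have hmem : ∀ x, x ∈ N.toFinite.toFinset.toList ↔ x ∈ N := by simp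
  obtain ⟨l, A, B, hl, hA, hB, htour⟩ := exists_tour_disc pos (pos c) N.toFinite.toFinset.toList
    (fun x hx => (hN x ((hmem x).1 hx)).2) hr
  simp only [hmem] at hl hA hB
  cases l with
  | nil =>
    refine ⟨⊥, bot_le, fun x hx => by simp [← hl] at hx, ?_⟩
    rw [edgeSum_bot]
    have := Real.rpow_nonneg hr α
    positivity
  | cons y l =>
    have hy : y ∈ N := (hl y).1 (by simp)
    obtain ⟨hadj, hyr⟩ := hN y hy
    obtain ⟨K, hKG, hK, hKw⟩ := exists_graph_of_tour hG hα hN hB hr l y hy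
      fun x hx => (hl x).1 (by simp [hx])
    refine ⟨SimpleGraph.edge c y ⊔ K, sup_le ?_ hKG, fun x hx => ?_, ?_⟩
    · rwa [SimpleGraph.edge_le_iff, or_iff_right hadj.ne]
    · have hcy : (SimpleGraph.edge c y ⊔ K).Reachable c y := by
        refine SimpleGraph.Adj.reachable (Or.inl ?_)
        rw [SimpleGraph.edge_adj]
        exact ⟨Or.inl ⟨rfl, rfl⟩, hadj.ne⟩
      rcases List.mem_cons.1 ((hl x).2 hx) with rfl | hx
      · exact hcy
      · exact hK _ le_sup_right hcy x hx
    · have h1 := edgeSum_sup_le (edgeEnergy_nonneg (pos := pos) (α := α))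
        (SimpleGraph.edge c y) K
      have h2 := edgeSum_edge_le (edgeEnergy_nonneg (pos := pos) (α := α)) c y
      have h3 := rpow_le_mul_sq dist_nonneg hyr hα
      -- the dropped first step is at least as long as the link from `c` that replaces it
      have h4 : r ^ (α - 2) * dist (pos c) (pos y) ^ 2 ≤
          r ^ (α - 2) * dist A (pos y) ^ 2 := by
        gcongr
        exact hyr.trans (hA y hy)
      have h5 := mul_le_mul_of_nonneg_left htour hr2
      have h6 := rpow_eq_mul_sq hr hα
      rw [edgeEnergy_mk, linkEnergy] at h2
      rw [tourSq, mul_add] at h5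
      linarith

/-- The neighbours of `v` in `T` can be joined to `v` by links whose total weight is at most a
constant times the transmission power of `v`. -/
lemma exists_graph_of_txPower (hG : IsOmnidirectional pos G) (hα : 2 ≤ α) (T : G.Subgraph)
    (v : V) :
    ∃ K ≤ G, (∀ x, T.Adj v x → K.Reachable v x) ∧
      edgeSum (edgeEnergy pos α) K ≤ 47 / 2 * txPower pos α T v := by
  rcases (T.neighborSet v).eq_empty_or_nonempty with h | h
  · refine ⟨⊥, bot_le, fun x hx => ?_, ?_⟩
    · have : x ∈ T.neighborSet v := hx
      simp [h] at this
    · rw [edgeSum_bot]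
      have := txPower_nonneg (pos := pos) (α := α) T v
      positivity
  · obtain ⟨w, hw, hmax⟩ := Set.exists_max_image (T.neighborSet v)
      (fun x => dist (pos v) (pos x)) (Set.toFinite _) h
    obtain ⟨K, hKG, hK, hKw⟩ := exists_graph_of_neighbors hG hα (dist_nonneg (x := pos v))
      (N := T.neighborSet v) fun x hx => ⟨T.adj_sub hx, hmax x hx⟩
    refine ⟨K, hKG, hK, hKw.trans ?_⟩
    gcongr
    exact le_csSup (Set.toFinite _).bddAbove ⟨w, hw, rfl⟩

end Star

/-! ### Comparison of the session energy with the weight of trees -/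

section Session

variable {V : Type*} [Fintype V] {pos : V → Plane} {G : SimpleGraph V} {α εr : ℝ} {M : Finset V}

/-- In a connected subgraph, a link not containing `u` has an internal end point. -/
lemma isInternal_or_of_adj {T : G.Subgraph} (hT : T.coe.Connected) {u x y : V}
    (hu : u ∈ T.verts) (hxy : T.Adj x y) (hx : x ≠ u) (hy : y ≠ u) :
    IsInternal T x ∨ IsInternal T y := by
  by_contra! hcon
  -- otherwise no link leaves `{x, y}`
  have leaf : ∀ p q z, ¬ IsInternal T p → T.Adj p q → T.Adj p z → z = q := by
    intro p q z hp hq hz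
    by_contra hne
    exact hp ((Set.one_lt_ncard_iff (Set.toFinite _)).2 ⟨z, q, hz, hq, hne⟩)
  have hstay : ∀ z, Relation.ReflTransGen T.spanningCoe.Adj x z → z = x ∨ z = y := by
    intro z hz
    induction hz with
    | refl => exact Or.inl rfl
    | tail _ hadj ih =>
      rename_i b c
      by_contra! hc
      rcases ih with rfl | rfl
      · exact hc.2 (leaf _ _ _ hcon.1 hxy hadj)
      · exact hc.1 (leaf _ _ _ hcon.2 hxy.symm hadj)
  have hreach : T.spanningCoe.Reachable x u := spanningCoe_reachable hT (T.edge_vert hxy) hu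
  rw [SimpleGraph.reachable_iff_reflTransGen] at hreach
  rcases hstay u hreach with rfl | rfl
  · exact hx rfl
  · exact hy rfl

open Classical in
/-- The nodes that transmit a packet of `u` over `T` with their power in `T` provide a multicast
tree whose weight is at most a constant times their total power. -/
lemma exists_multicastTree_weight_le (hG : IsOmnidirectional pos G) (hα : 2 ≤ α)
    {T : G.Subgraph} (hT : IsMulticastTree M T) {u : V} (hu : u ∈ M) :
    ∃ T' : G.Subgraph, IsMulticastTree M T' ∧ treeWeight pos α T' ≤
      47 / 2 * ∑ v : V with v ∈ T.verts ∧ (v = u ∨ IsInternal T v), txPower pos α T v := by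
  choose K hKG hK hKw using exists_graph_of_txPower (pos := pos) (α := α) hG hα T
  set I : Finset V := {v : V | v ∈ T.verts ∧ (v = u ∨ IsInternal T v)} with hI
  have huT := hT.2 hu
  have hadj : ∀ x y, T.Adj x y → (I.sup K).Reachable x y := by
    intro x y hxy
    have key : x ∈ I ∨ y ∈ I := by
      simp only [hI, Finset.mem_filter, Finset.mem_univ, true_and]
      by_cases hx : x = u
      · exact Or.inl ⟨T.edge_vert hxy, Or.inl hx⟩
      by_cases hy : y = u
      · exact Or.inr ⟨T.edge_vert hxy.symm, Or.inl hy⟩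
      exact (isInternal_or_of_adj hT.1.connected huT hxy hx hy).imp
        (fun h => ⟨T.edge_vert hxy, Or.inr h⟩) fun h => ⟨T.edge_vert hxy.symm, Or.inr h⟩
    rcases key with h | h
    · exact (hK x y hxy).mono (Finset.le_sup h)
    · exact ((hK y x hxy.symm).mono (Finset.le_sup h)).symm
  obtain ⟨T', hT', hle, -⟩ := exists_multicastTree_le (M := M) (K := I.sup K) (c := u)
    (Finset.sup_le fun v _ => hKG v) fun x hx =>
      reachable_of_forall_adj hadj (spanningCoe_reachable hT.1.connected huT (hT.2 hx))
  refine ⟨T', hT', ?_⟩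
  rw [treeWeight_eq_edgeSum, Finset.mul_sum]
  calc edgeSum (edgeEnergy pos α) T'.spanningCoe
      ≤ edgeSum (edgeEnergy pos α) (I.sup K) := edgeSum_mono edgeEnergy_nonneg hle
    _ ≤ ∑ v ∈ I, edgeSum (edgeEnergy pos α) (K v) := edgeSum_finset_sup_le edgeEnergy_nonneg I K
    _ ≤ _ := Finset.sum_le_sum fun v _ => hKw v

/-- Every link is the strongest one of at most two nodes. -/
lemma sum_txPower_le (T : G.Subgraph) : ∑ v, txPower pos α T v ≤ 2 * treeWeight pos α T := by
  classical
  have h1 : ∀ v, txPower pos α T v ≤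
      ∑ e ∈ edges T.spanningCoe with v ∈ e, edgeEnergy pos α e := by
    intro v
    refine Real.sSup_le ?_ (Finset.sum_nonneg fun e _ => edgeEnergy_nonneg e)
    rintro _ ⟨x, hx, rfl⟩
    rw [← edgeEnergy_mk]
    refine Finset.single_le_sum (f := edgeEnergy pos α) (fun e _ => edgeEnergy_nonneg e) ?_
    simpa using hx
  have h2 : ∀ e : Sym2 V, ∑ v : V with v ∈ e, edgeEnergy pos α e ≤ 2 * edgeEnergy pos α e := by
    intro e
    rw [Finset.sum_const, nsmul_eq_mul]
    gcongr
    · exact edgeEnergy_nonneg e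
    · induction e with
      | _ x y =>
        have : (Finset.univ.filter fun v => v ∈ s(x, y)) ⊆ {x, y} := by
          intro v
          simp
        exact_mod_cast (Finset.card_le_card this).trans Finset.card_le_two
  calc ∑ v, txPower pos α T v
      ≤ ∑ v, ∑ e ∈ edges T.spanningCoe with v ∈ e, edgeEnergy pos α e :=
        Finset.sum_le_sum fun v _ => h1 v
    _ = ∑ e ∈ edges T.spanningCoe, ∑ v : V with v ∈ e, edgeEnergy pos α e := by
        simp_rw [Finset.sum_filter]
        exact Finset.sum_comm
    _ ≤ ∑ e ∈ edges T.spanningCoe, 2 * edgeEnergy pos α e := Finset.sum_le_sum fun e _ => h2 e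
    _ = 2 * treeWeight pos α T := by rw [← Finset.mul_sum, treeWeight_eq_edgeSum, edgeSum]

/-- A tree on `n` nodes has `n - 1` links, and each of them costs at least one reception. -/
lemma reception_le_treeWeight (hrx : ∀ u v : V, G.Adj u v → εr ≤ linkEnergy pos α u v)
    {T : G.Subgraph} (hT : T.coe.IsTree) :
    ((T.verts.ncard : ℝ) - 1) * εr ≤ treeWeight pos α T := by
  classical
  have hcard : T.verts.ncard = (edges T.spanningCoe).card + 1 := by
    have h1 : (edges T.spanningCoe : Set (Sym2 V)) = T.edgeSet := by
      ext e
      simp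
    rw [← Nat.card_coe_set_eq, Nat.card_eq_fintype_card, ← hT.card_edgeFinset,
      ← Set.ncard_coe_finset, ← Set.ncard_coe_finset, h1, SimpleGraph.coe_edgeFinset,
      ← SimpleGraph.Subgraph.image_coe_edgeSet_coe,
      Set.ncard_image_of_injective _ (Sym2.map.injective Subtype.val_injective)]
  rw [hcard, treeWeight_eq_edgeSum, edgeSum]
  push_cast
  rw [add_sub_cancel_right, ← nsmul_eq_mul]
  refine Finset.card_nsmul_le_sum _ _ _ fun e he => ?_
  induction e with
  | _ x y =>
    rw [mem_edges, SimpleGraph.mem_edgeSet, SimpleGraph.Subgraph.spanningCoe_adj] at he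
    exact hrx x y (T.adj_sub he)

/-- Per packet, a tree spends at most three times its weight: two times for transmissions, once for
receptions. Combined with a lower bound on the energy spent by any multicast tree, this makes every
`2`-approximate Steiner tree an approximation of minimal session energy. -/
theorem IsSteinerApprox.isMEAAMApprox (hG : IsOmnidirectional pos G) (hα : 2 ≤ α) (hεr : 0 ≤ εr)
    (hrx : ∀ u v : V, G.Adj u v → εr ≤ linkEnergy pos α u v) (p : V → ℕ) {T : G.Subgraph}
    (hT : IsSteinerApprox pos α 2 M T) : IsMEAAMApprox pos α εr 145 M p T := by
  classical
  refine ⟨hT.1, fun T' hT' => ?_⟩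
  unfold sessionEnergy
  rw [Finset.mul_sum]
  refine Finset.sum_le_sum fun u hu => ?_
  rw [mul_left_comm]
  refine mul_le_mul_of_nonneg_left ?_ (Nat.cast_nonneg _)
  obtain ⟨T'', hT'', hw⟩ :=
    exists_multicastTree_weight_le (pos := pos) hG hα hT' hu
  have h1 := hT.2 T'' hT''
  have h2 := sum_txPower_le (pos := pos) (α := α) T
  have h3 := reception_le_treeWeight hrx hT.1.1
  have h4 : ∑ v : V with v ∈ T.verts ∧ (v = u ∨ IsInternal T v), txPower pos α T v ≤
      ∑ v, txPower pos α T v :=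
    Finset.sum_le_sum_of_subset_of_nonneg (Finset.filter_subset _ _)
      fun v _ _ => txPower_nonneg T v
  have h5 : 0 ≤ ∑ v : V with v ∈ T'.verts ∧ (v = u ∨ IsInternal T' v), txPower pos α T' v :=
    Finset.sum_nonneg fun v _ => txPower_nonneg T' v
  have h6 : 0 ≤ ((T'.verts.ncard : ℝ) - 1) * εr := by
    refine mul_nonneg ?_ hεr
    have : 0 < T'.verts.ncard := (Set.ncard_pos (Set.toFinite _)).2 ⟨u, hT'.2 hu⟩
    rw [sub_nonneg]
    exact_mod_cast this
  linarith

end Session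

/-! ### Executions of the Steiner tree algorithm -/

section Execution

variable {V : Type*} {pos : V → Plane} {G : SimpleGraph V} {α : ℝ} {M : Finset V}

/-- The properties of a state that every step preserves: the fragments are a partition of the
members, and each of them is connected by marked links. -/
structure SteinerState.Valid (M : Finset V) (s : SteinerState G) : Prop where
  nonempty : ∀ A ∈ s.fragments, A.Nonempty
  eq_of_mem : ∀ A ∈ s.fragments, ∀ B ∈ s.fragments, ∀ x, x ∈ A → x ∈ B → A = B
  mem_iff : ∀ x, x ∈ M ↔ ∃ A ∈ s.fragments, x ∈ A
  subset_marked : (M : Set V) ⊆ s.marked.verts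
  reachable : ∀ A ∈ s.fragments, ∀ x ∈ A, ∀ y ∈ A, s.marked.spanningCoe.Reachable x y

lemma valid_init : (SteinerState.init G M).Valid M where
  nonempty := by
    rintro A ⟨m, -, rfl⟩
    exact Set.singleton_nonempty m
  eq_of_mem := by
    rintro A ⟨m, -, rfl⟩ B ⟨m', -, rfl⟩ x rfl hx
    rw [Set.mem_singleton_iff.1 hx]
  mem_iff x := by
    constructor
    · exact fun hx => ⟨{x}, ⟨x, hx, rfl⟩, rfl⟩
    · rintro ⟨A, ⟨m, hm, rfl⟩, rfl⟩
      exact hm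
  subset_marked := fun x hx => hx
  reachable := by
    rintro A ⟨m, -, rfl⟩ x rfl y rfl
    rfl

lemma SteinerState.Valid.step {s t : SteinerState G} (hs : s.Valid M)
    (hst : SteinerStep pos α s t) : t.Valid M := by
  obtain ⟨A, hA, B, hB, hAB, a, ha, b, hb, w, -, -, -, hfrag, hmark⟩ := hst
  have hle : s.marked.spanningCoe ≤ t.marked.spanningCoe := by
    intro x y h
    rw [hmark]
    exact Or.inl h
  have hab : t.marked.spanningCoe.Reachable a b := by
    refine SimpleGraph.Reachable.mono (G := w.toSubgraph.spanningCoe) ?_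
      (spanningCoe_reachable w.toSubgraph_connected.coe
        w.start_mem_verts_toSubgraph w.end_mem_verts_toSubgraph)
    intro x y h
    rw [hmark]
    exact Or.inr h
  refine ⟨?_, ?_, ?_, ?_, ?_⟩
  · rw [hfrag]
    rintro C (hC | rfl)
    · exact hs.nonempty C hC.1
    · exact ⟨a, Or.inl ha⟩
  · have key : ∀ C ∈ s.fragments \ {A, B}, ∀ x ∈ C, x ∉ A ∪ B := by
      rintro C ⟨hC, hne⟩ x hx (h | h)
      · exact hne (Or.inl (hs.eq_of_mem C hC A hA x hx h))
      · exact hne (Or.inr (hs.eq_of_mem C hC B hB x hx h))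
    rw [hfrag]
    rintro C (hC | rfl) D (hD | rfl) x hxC hxD
    · exact hs.eq_of_mem C hC.1 D hD.1 x hxC hxD
    · exact (key C hC x hxC hxD).elim
    · exact (key D hD x hxD hxC).elim
    · rfl
  · intro x
    rw [hs.mem_iff, hfrag]
    constructor
    · rintro ⟨C, hC, hx⟩
      by_cases h : C = A ∨ C = B
      · refine ⟨A ∪ B, Or.inr rfl, ?_⟩
        rcases h with rfl | rfl
        · exact Or.inl hx
        · exact Or.inr hx
      · exact ⟨C, Or.inl ⟨hC, h⟩, hx⟩
    · rintro ⟨C, hC | rfl, hx⟩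
      · exact ⟨C, hC.1, hx⟩
      · rcases hx with hx | hx
        · exact ⟨A, hA, hx⟩
        · exact ⟨B, hB, hx⟩
  · rw [hmark]
    exact fun x hx => Or.inl (hs.subset_marked hx)
  · rw [hfrag]
    rintro C (hC | rfl) x hx y hy
    · exact (hs.reachable C hC.1 x hx y hy).mono hle
    · have key : ∀ z ∈ A ∪ B, t.marked.spanningCoe.Reachable a z := by
        rintro z (hz | hz)
        · exact (hs.reachable A hA a ha z hz).mono hle
        · exact hab.trans ((hs.reachable B hB b hb z hz).mono hle)
      exact (key x hx).symm.trans (key y hy)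

lemma SteinerReachable.valid {s : SteinerState G} (h : SteinerReachable pos α M s) :
    s.Valid M := by
  induction h with
  | refl => exact valid_init
  | tail _ hst ih => exact ih.step hst

lemma ncard_fragments_lt [Finite V] {s t : SteinerState G} (hst : SteinerStep pos α s t) :
    t.fragments.ncard < s.fragments.ncard := by
  obtain ⟨A, hA, B, hB, hAB, -, -, -, -, -, -, -, -, hfrag, -⟩ := hst
  have hsub : {A, B} ⊆ s.fragments := Set.insert_subset hA (Set.singleton_subset_iff.2 hB)
  have h1 := Set.ncard_sdiff_add_ncard_of_subset hsub (Set.toFinite _)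
  have h2 := Set.ncard_union_le (s.fragments \ {A, B}) {A ∪ B}
  rw [Set.ncard_pair hAB] at h1
  rw [Set.ncard_singleton, ← hfrag] at h2
  omega

theorem not_exists_infinite_run [Finite V] (run : ℕ → SteinerState G) :
    ¬ ∀ n, SteinerStep pos α (run n) (run (n + 1)) := by
  intro h
  have key : ∀ n, (run n).fragments.ncard + n ≤ (run 0).fragments.ncard := by
    intro n
    induction n with
    | zero => rfl
    | succ n ih =>
      have := ncard_fragments_lt (h n)
      omega
  have := key ((run 0).fragments.ncard + 1)
  omega

/-- As long as there are two fragments, a lightest path between members of different fragments is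
preferred by both of the fragments it joins. -/
lemma exists_step [Finite V] {s : SteinerState G} (hs : s.Valid M)
    (hconn : ∀ u ∈ M, ∀ v ∈ M, G.Reachable u v) {A B : Set V} (hA : A ∈ s.fragments)
    (hB : B ∈ s.fragments) (hAB : A ≠ B) : ∃ t, SteinerStep pos α s t := by
  classical
  have := Fintype.ofFinite V
  let S : Set (Σ x y : V, G.Path x y) :=
    {q | ∃ C ∈ s.fragments, ∃ D ∈ s.fragments, C ≠ D ∧ q.1 ∈ C ∧ q.2.1 ∈ D}
  have hS : S.Nonempty := by
    obtain ⟨a, ha⟩ := hs.nonempty A hA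
    obtain ⟨b, hb⟩ := hs.nonempty B hB
    obtain ⟨p⟩ := hconn a ((hs.mem_iff a).2 ⟨A, hA, ha⟩) b ((hs.mem_iff b).2 ⟨B, hB, hb⟩)
    exact ⟨⟨a, b, p.toPath⟩, A, hA, B, hB, hAB, ha, hb⟩
  obtain ⟨⟨a, b, w⟩, ⟨C, hC, D, hD, hCD, ha, hb⟩, hmin⟩ := Set.exists_min_image S
    (fun q => walkEnergy pos α q.2.2.1) (Set.toFinite _) hS
  have hpref : ∀ E ∈ s.fragments, IsPreferred pos α s E w.1 := by
    intro E hE F hF hne x hx y hy q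
    exact (hmin ⟨x, y, q.toPath⟩ ⟨E, hE, F, hF, hne.symm, hx, hy⟩).trans (walkEnergy_bypass_le q)
  exact ⟨⟨(s.fragments \ {C, D}) ∪ {C ∪ D}, s.marked ⊔ w.1.toSubgraph⟩, C, hC, D, hD, hCD, a, ha,
    b, hb, w.1, w.2, hpref C hC, hpref D hD, rfl, rfl⟩

theorem isFinal_of_not_step [Finite V] {s : SteinerState G} (hs : s.Valid M)
    (hconn : ∀ u ∈ M, ∀ v ∈ M, G.Reachable u v) (hM : M.Nonempty)
    (hhalt : ¬ ∃ t, SteinerStep pos α s t) : s.IsFinal M := by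
  obtain ⟨m, hm⟩ := hM
  obtain ⟨A, hA, hmA⟩ := (hs.mem_iff m).1 hm
  have heq : ∀ B ∈ s.fragments, B = A := by
    intro B hB
    by_contra hne
    exact hhalt (exists_step hs hconn hB hA hne)
  have hAM : A = (M : Set V) := by
    ext x
    rw [Finset.mem_coe, hs.mem_iff]
    exact ⟨fun hx => ⟨A, hA, hx⟩, fun ⟨B, hB, hx⟩ => heq B hB ▸ hx⟩
  subst hAM
  exact Set.eq_singleton_iff_unique_mem.2 ⟨hA, heq⟩

theorem exists_output {s : SteinerState G} (hs : s.Valid M) (hM : M.Nonempty)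
    (hfin : s.IsFinal M) : ∃ T, s.IsOutput M T := by
  obtain ⟨m, hm⟩ := hM
  have hMs : (M : Set V) ∈ s.fragments := by
    rw [show s.fragments = {(M : Set V)} from hfin]
    rfl
  obtain ⟨T, hT, hle, hverts⟩ := exists_multicastTree_le (M := M) (c := m)
    s.marked.spanningCoe_le fun x hx => hs.reachable _ hMs m hm x hx
  refine ⟨T, hfin, ⟨fun x hx => ?_, fun _ _ h => hle h⟩, hT⟩
  obtain ⟨p⟩ := (hverts x hx).symm
  cases p with
  | nil => exact hs.subset_marked hm
  | cons h _ => exact s.marked.edge_vert h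

end Execution

/-! ### The weight of the marked links -/

section Approximation

variable {V : Type*} {pos : V → Plane} {G : SimpleGraph V} {α : ℝ} {M : Finset V}

/-- Least energy of a walk between the two given nodes (`0` if there is none). -/
noncomputable def pathEnergy (pos : V → Plane) (α : ℝ) (G : SimpleGraph V) : Sym2 V → ℝ :=
  Sym2.lift ⟨fun x y => ⨅ q : G.Walk x y, walkEnergy pos α q, fun _ _ =>
    Equiv.iInf_congr ⟨.reverse, .reverse, SimpleGraph.Walk.reverse_reverse,
      SimpleGraph.Walk.reverse_reverse⟩ fun q => walkEnergy_reverse q⟩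

lemma pathEnergy_nonneg (e : Sym2 V) : 0 ≤ pathEnergy pos α G e := by
  induction e with
  | _ x y => exact Real.iInf_nonneg fun q => walkEnergy_nonneg q

lemma pathEnergy_le {x y : V} (q : G.Walk x y) :
    pathEnergy pos α G s(x, y) ≤ walkEnergy pos α q :=
  ciInf_le ⟨0, by rintro _ ⟨q, rfl⟩; exact walkEnergy_nonneg q⟩ q

lemma le_pathEnergy {x y : V} (h : G.Reachable x y) {c : ℝ}
    (hc : ∀ q : G.Walk x y, c ≤ walkEnergy pos α q) : c ≤ pathEnergy pos α G s(x, y) :=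
  have : Nonempty (G.Walk x y) := h
  le_ciInf hc

/-- Joining each member on a walk to the next one gives a connected graph on these members whose
weight with respect to `pathEnergy` is at most the energy of the walk. The induction runs from the
end of the walk; `m` is the first member met on the part treated so far. -/
lemma exists_memberGraph_of_walk [Fintype V] {z y : V} (p : G.Walk z y) (hy : y ∈ M) :
    ∃ m ∈ M, G.Reachable z m ∧ ∃ F : SimpleGraph V, (∀ a b, F.Adj a b → a ∈ M) ∧
      (∀ x ∈ M, x ∈ p.support → F.Reachable m x) ∧
      pathEnergy pos α G s(z, m) + edgeSum (pathEnergy pos α G) F ≤ walkEnergy pos α p := by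
  induction p with
  | @nil z =>
    refine ⟨z, hy, .rfl, ⊥, by simp, fun x _ hx => ?_, ?_⟩
    · rw [SimpleGraph.Walk.support_nil, List.mem_singleton] at hx
      rw [hx]
    rw [edgeSum_bot, add_zero]
    exact pathEnergy_le _
  | @cons z z' y h p ih =>
    obtain ⟨m, hm, hzm, F, hFM, hF, hw⟩ := ih hy
    have hstep : pathEnergy pos α G s(z, m) ≤
        linkEnergy pos α z z' + pathEnergy pos α G s(z', m) := by
      rw [← sub_le_iff_le_add']
      refine le_pathEnergy hzm fun q => ?_
      rw [sub_le_iff_le_add', ← walkEnergy_cons h]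
      exact pathEnergy_le _
    rw [walkEnergy_cons]
    by_cases hz : z ∈ M
    · refine ⟨z, hz, .rfl, SimpleGraph.edge z m ⊔ F, ?_, fun x hx hxp => ?_, ?_⟩
      · rintro a b (hab | hab)
        · rw [SimpleGraph.edge_adj] at hab
          rcases hab.1 with ⟨rfl, rfl⟩ | ⟨rfl, rfl⟩ <;> assumption
        · exact hFM a b hab
      · have hzm' : (SimpleGraph.edge z m ⊔ F).Reachable z m := by
          by_cases heq : z = m
          · rw [heq]
          · refine SimpleGraph.Adj.reachable (Or.inl ?_)
            rw [SimpleGraph.edge_adj]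
            exact ⟨Or.inl ⟨rfl, rfl⟩, heq⟩
        rw [SimpleGraph.Walk.support_cons, List.mem_cons] at hxp
        rcases hxp with rfl | hxp
        · rfl
        · exact hzm'.trans ((hF x hx hxp).mono le_sup_right)
      · have h1 := edgeSum_sup_le (pathEnergy_nonneg (pos := pos) (α := α) (G := G))
          (SimpleGraph.edge z m) F
        have h2 := edgeSum_edge_le (pathEnergy_nonneg (pos := pos) (α := α) (G := G)) z m
        have h3 := pathEnergy_le (pos := pos) (α := α) (.nil : G.Walk z z)
        rw [walkEnergy_nil] at h3
        linarith
    · refine ⟨m, hm, h.reachable.trans hzm, F, hFM, fun x hx hxp => ?_, by linarith⟩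
      rw [SimpleGraph.Walk.support_cons, List.mem_cons] at hxp
      rcases hxp with rfl | hxp
      · exact (hz hx).elim
      · exact hF x hx hxp

/-- All nodes joined to `c` by `K` lie on a closed walk that spends at most twice the weight of
`K`: the walk is extended by a detour over one further link at a time. -/
lemma exists_closedWalk [Fintype V] {K : SimpleGraph V} (hK : K ≤ G) (c : V) :
    ∃ p : G.Walk c c, (∀ x, K.Reachable c x → x ∈ p.support) ∧
      walkEnergy pos α p ≤ 2 * edgeSum (edgeEnergy pos α) K := by
  classical
  have key : ∀ n : ℕ, ∃ p : G.Walk c c, ∃ L ≤ K, (∀ a b, L.Adj a b → a ∈ p.support) ∧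
      walkEnergy pos α p ≤ 2 * edgeSum (edgeEnergy pos α) L ∧
      (n ≤ p.support.toFinset.card ∨ ∀ x, K.Reachable c x → x ∈ p.support) := by
    intro n
    induction n with
    | zero => exact ⟨.nil, ⊥, bot_le, by simp, by simp [edgeSum_bot], by simp⟩
    | succ n ih =>
      obtain ⟨p, L, hLK, hLp, hw, hn⟩ := ih
      by_cases hall : ∀ x, K.Reachable c x → x ∈ p.support
      · exact ⟨p, L, hLK, hLp, hw, Or.inr hall⟩
      replace hn := hn.resolve_right hall
      obtain ⟨a, b, hab, ha, hb⟩ : ∃ a b, K.Adj a b ∧ a ∈ p.support ∧ b ∉ p.support := by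
        by_contra! hcon
        refine hall fun x hx => ?_
        rw [SimpleGraph.reachable_iff_reflTransGen] at hx
        induction hx with
        | refl => exact p.start_mem_support
        | tail _ hadj ih => exact hcon _ _ hadj ih
      let d : G.Walk a a := .cons (hK hab) (.cons (hK hab).symm .nil)
      let p' : G.Walk c c := (p.takeUntil a ha).append (d.append (p.dropUntil a ha))
      have hp' : ∀ x, x ∈ p'.support ↔ x = b ∨ x ∈ p.support := by
        intro x
        have h1 : x ∈ p.support ↔ x ∈ (p.takeUntil a ha).support ∨
            x ∈ (p.dropUntil a ha).support := by
          rw [← SimpleGraph.Walk.mem_support_append_iff, SimpleGraph.Walk.take_spec]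
        have h2 : a ∈ (p.dropUntil a ha).support := SimpleGraph.Walk.start_mem_support _
        simp only [p', d, SimpleGraph.Walk.mem_support_append_iff, h1,
          SimpleGraph.Walk.support_cons, SimpleGraph.Walk.support_nil, List.mem_cons,
          List.not_mem_nil, or_false]
        constructor
        · rintro (h | (rfl | rfl | rfl) | h) <;> tauto
        · tauto
      have hpw : walkEnergy pos α p' = walkEnergy pos α p + 2 * linkEnergy pos α a b := by
        have h1 : walkEnergy pos α p = walkEnergy pos α (p.takeUntil a ha) +
            walkEnergy pos α (p.dropUntil a ha) := by
          rw [← walkEnergy_append, SimpleGraph.Walk.take_spec]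
        simp only [p', d, walkEnergy_append, walkEnergy_cons, walkEnergy_nil, h1,
          linkEnergy_comm pos α b a]
        ring
      refine ⟨p', L ⊔ SimpleGraph.edge a b, sup_le hLK ?_, ?_, ?_, Or.inl ?_⟩
      · rwa [SimpleGraph.edge_le_iff, or_iff_right hab.ne]
      · rintro x y (hxy | hxy)
        · exact (hp' x).2 (Or.inr (hLp x y hxy))
        · rw [SimpleGraph.edge_adj] at hxy
          rcases hxy.1 with ⟨rfl, rfl⟩ | ⟨rfl, rfl⟩
          · exact (hp' _).2 (Or.inr ha)
          · exact (hp' _).2 (Or.inl rfl)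
      · have hmem : s(a, b) ∈ (L ⊔ SimpleGraph.edge a b).edgeSet := by
          refine Or.inr ?_
          rw [SimpleGraph.edge_adj]
          exact ⟨Or.inl ⟨rfl, rfl⟩, hab.ne⟩
        -- the new link is not in `L`, since its end point `b` is new
        have hle : L ≤ (L ⊔ SimpleGraph.edge a b).deleteEdges {s(a, b)} := by
          intro x y hxy
          rw [SimpleGraph.deleteEdges_adj]
          refine ⟨Or.inl hxy, fun h => ?_⟩
          rcases Sym2.eq_iff.1 h with ⟨rfl, rfl⟩ | ⟨rfl, rfl⟩
          · exact hb (hLp _ _ hxy.symm)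
          · exact hb (hLp _ _ hxy)
        have h1 := edgeSum_mono (edgeEnergy_nonneg (pos := pos) (α := α)) hle
        have h2 := edgeSum_deleteEdges_add (f := edgeEnergy pos α) hmem
        rw [edgeEnergy_mk] at h2
        linarith
      · have hsub : p'.support.toFinset = insert b p.support.toFinset := by
          ext x
          simp [hp']
        rw [hsub, Finset.card_insert_of_notMem (by simpa using hb)]
        omega
  obtain ⟨p, L, hLK, -, hw, hn⟩ := key (Fintype.card V + 1)
  refine ⟨p, hn.resolve_left fun h => ?_, hw.trans ?_⟩
  · have := p.support.toFinset.card_le_univ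
    omega
  · gcongr
    exact edgeSum_mono edgeEnergy_nonneg hLK

/-- The graph on the nodes in which every fragment is a clique. -/
def fragmentGraph (s : SteinerState G) : SimpleGraph V where
  Adj x y := x ≠ y ∧ ∃ C ∈ s.fragments, x ∈ C ∧ y ∈ C
  symm := ⟨fun _ _ ⟨h, C, hC, hx, hy⟩ => ⟨h.symm, C, hC, hy, hx⟩⟩
  loopless := ⟨fun _ h => h.1 rfl⟩

lemma fragmentGraph_reachable {s : SteinerState G} {C : Set V} (hC : C ∈ s.fragments) {x y : V}
    (hx : x ∈ C) (hy : y ∈ C) : (fragmentGraph s).Reachable x y := by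
  by_cases h : x = y
  · rw [h]
  · exact SimpleGraph.Adj.reachable ⟨h, C, hC, hx, hy⟩

/-- The last edge at which a walk from `A` to `b ∉ A` leaves `A`: from there on, it stays outside
of `A`. -/
lemma exists_last_exit {L O : SimpleGraph V} {A : Set V}
    (hO : ∀ x y, L.Adj x y → x ∉ A → y ∉ A → O.Adj x y) {a b : V} (ha : a ∈ A) (hb : b ∉ A)
    (hab : L.Reachable a b) : ∃ x ∈ A, ∃ y ∉ A, L.Adj x y ∧ O.Reachable y b := by
  have key : ∀ {z b : V} (_ : L.Walk z b), b ∉ A →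
      (z ∉ A ∧ O.Reachable z b) ∨ ∃ x ∈ A, ∃ y ∉ A, L.Adj x y ∧ O.Reachable y b := by
    intro z b p hb
    induction p with
    | nil => exact Or.inl ⟨hb, .rfl⟩
    | @cons z z' b h p ih =>
      rcases ih hb with ⟨hz', hr⟩ | h'
      · by_cases hz : z ∈ A
        · exact Or.inr ⟨z, hz, z', hz', h, hr⟩
        · exact Or.inl ⟨hz, (hO z z' h hz hz').reachable.trans hr⟩
      · exact Or.inr h'
  obtain ⟨p⟩ := hab
  exact (key p hb).resolve_left fun h => h.1 ha

/-- The exchange argument. The state `s` is completed by a graph `F` on the members that joins all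
fragments. When two fragments merge along a preferred path, an edge of `F` leaving one of them
becomes superfluous, and it weighs at least as much as that path. -/
lemma exists_completion_step [Fintype V] {s t : SteinerState G} (hs : s.Valid M)
    (hconn : ∀ u ∈ M, ∀ v ∈ M, G.Reachable u v) (hst : SteinerStep pos α s t) {F : SimpleGraph V}
    (hFM : ∀ x y, F.Adj x y → x ∈ M)
    (hF : ∀ x ∈ M, ∀ y ∈ M, (fragmentGraph s ⊔ F).Reachable x y) :
    ∃ F' ≤ F, (∀ x ∈ M, ∀ y ∈ M, (fragmentGraph t ⊔ F').Reachable x y) ∧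
      treeWeight pos α t.marked + edgeSum (pathEnergy pos α G) F' ≤
        treeWeight pos α s.marked + edgeSum (pathEnergy pos α G) F := by
  obtain ⟨A, hA, B, hB, hAB, a, ha, b, hb, w, -, hpref, -, hfrag, hmark⟩ := hst
  have hbA : b ∉ A := fun h => hAB (hs.eq_of_mem A hA B hB b h hb)
  have hABt : A ∪ B ∈ t.fragments := by
    rw [hfrag]
    exact Or.inr rfl
  have hfg : fragmentGraph s ≤ fragmentGraph t := by
    rintro x y ⟨hne, C, hC, hx, hy⟩
    by_cases h : C = A ∨ C = B
    · refine ⟨hne, A ∪ B, hABt, ?_⟩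
      rcases h with rfl | rfl
      · exact ⟨Or.inl hx, Or.inl hy⟩
      · exact ⟨Or.inr hx, Or.inr hy⟩
    · refine ⟨hne, C, ?_, hx, hy⟩
      rw [hfrag]
      exact Or.inl ⟨hC, h⟩
  let O : SimpleGraph V :=
    { Adj := fun x y => (fragmentGraph s ⊔ F).Adj x y ∧ x ∉ A ∧ y ∉ A
      symm := ⟨fun x y h => ⟨h.1.symm, h.2.2, h.2.1⟩⟩
      loopless := ⟨fun x h => h.1.ne rfl⟩ }
  obtain ⟨x, hx, y, hy, hxy, hyb⟩ := exists_last_exit (O := O)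
    (fun x y h hx hy => ⟨h, hx, hy⟩) ha hbA
    (hF a ((hs.mem_iff a).2 ⟨A, hA, ha⟩) b ((hs.mem_iff b).2 ⟨B, hB, hb⟩))
  have hFxy : F.Adj x y := by
    rcases hxy with ⟨-, C, hC, hxC, hyC⟩ | h
    · exact (hy (hs.eq_of_mem C hC A hA x hxC hx ▸ hyC)).elim
    · exact h
  have hOle : O ≤ fragmentGraph t ⊔ F.deleteEdges {s(x, y)} := by
    rintro p q ⟨h | h, hp, hq⟩
    · exact Or.inl (hfg h)
    · refine Or.inr ?_
      rw [SimpleGraph.deleteEdges_adj]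
      refine ⟨h, fun heq => ?_⟩
      rcases Sym2.eq_iff.1 heq with ⟨rfl, rfl⟩ | ⟨rfl, rfl⟩
      · exact hp hx
      · exact hq hx
  have hxy' : (fragmentGraph t ⊔ F.deleteEdges {s(x, y)}).Reachable x y :=
    ((fragmentGraph_reachable hABt (Or.inl hx) (Or.inr hb)).mono le_sup_left).trans
      (hyb.mono hOle).symm
  refine ⟨F.deleteEdges {s(x, y)}, F.deleteEdges_le _, fun p hp q hq =>
    reachable_of_forall_adj ?_ (hF p hp q hq), ?_⟩
  · rintro p q (h | h)
    · exact SimpleGraph.Adj.reachable (Or.inl (hfg h))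
    · by_cases heq : s(p, q) = s(x, y)
      · rcases Sym2.eq_iff.1 heq with ⟨rfl, rfl⟩ | ⟨rfl, rfl⟩
        · exact hxy'
        · exact hxy'.symm
      · refine SimpleGraph.Adj.reachable (Or.inr ?_)
        rw [SimpleGraph.deleteEdges_adj]
        exact ⟨h, heq⟩
  · have hxM := hFM x y hFxy
    have hyM := hFM y x hFxy.symm
    obtain ⟨C, hC, hyC⟩ := (hs.mem_iff y).1 hyM
    have h1 : walkEnergy pos α w ≤ pathEnergy pos α G s(x, y) :=
      le_pathEnergy (hconn x hxM y hyM)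
        (hpref C hC (fun h => hy (h ▸ hyC)) x hx y hyC)
    have h2 := edgeSum_deleteEdges_add (f := pathEnergy pos α G) (e := s(x, y)) (K := F) hFxy
    have h3 : treeWeight pos α t.marked ≤ treeWeight pos α s.marked + walkEnergy pos α w := by
      have h4 := edgeSum_sup_le (edgeEnergy_nonneg (pos := pos) (α := α))
        s.marked.spanningCoe w.toSubgraph.spanningCoe
      have h5 := edgeSum_toSubgraph_le (pos := pos) (α := α) w
      have h6 : t.marked.spanningCoe = s.marked.spanningCoe ⊔ w.toSubgraph.spanningCoe := by
        rw [hmark]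
        rfl
      rw [treeWeight_eq_edgeSum, treeWeight_eq_edgeSum, h6]
      linarith
    linarith

/-- At every moment of an execution, the marked links and what is still needed to join the
fragments together weigh at most twice as much as any given multicast tree `T`. At the start, the
fragments are joined along a closed walk around `T`. -/
theorem exists_completion [Fintype V] (hconn : ∀ u ∈ M, ∀ v ∈ M, G.Reachable u v)
    (hM : M.Nonempty) {T : G.Subgraph} (hT : IsMulticastTree M T) {s : SteinerState G}
    (hs : SteinerReachable pos α M s) :
    ∃ F : SimpleGraph V, (∀ x y, F.Adj x y → x ∈ M) ∧
      (∀ x ∈ M, ∀ y ∈ M, (fragmentGraph s ⊔ F).Reachable x y) ∧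
      treeWeight pos α s.marked + edgeSum (pathEnergy pos α G) F ≤ 2 * treeWeight pos α T := by
  induction hs with
  | refl =>
    obtain ⟨c, hc⟩ := hM
    obtain ⟨p, hp, hpw⟩ := exists_closedWalk (pos := pos) (α := α) T.spanningCoe_le c
    obtain ⟨m, hm, -, F, hFM, hF, hFw⟩ := exists_memberGraph_of_walk (pos := pos) (α := α) p hc
    have hmem : ∀ x ∈ M, F.Reachable m x := fun x hx =>
      hF x hx (hp x (spanningCoe_reachable hT.1.connected (hT.2 hc) (hT.2 hx)))
    refine ⟨F, hFM, fun x hx y hy =>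
      ((hmem x hx).symm.trans (hmem y hy)).mono le_sup_right, ?_⟩
    have h0 : (SteinerState.init G M).marked.spanningCoe = ⊥ := rfl
    have h1 := pathEnergy_nonneg (pos := pos) (α := α) (G := G) s(c, m)
    rw [treeWeight_eq_edgeSum, treeWeight_eq_edgeSum, h0, edgeSum_bot]
    linarith
  | tail hs hst ih =>
    obtain ⟨F, hFM, hF, hFw⟩ := ih
    obtain ⟨F', hle, hF', hw⟩ :=
      exists_completion_step (SteinerReachable.valid hs) hconn hst hFM hF
    exact ⟨F', fun x y h => hFM x y (hle h), hF', hw.trans hFw⟩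

theorem SteinerState.IsOutput.isSteinerApprox [Fintype V]
    (hconn : ∀ u ∈ M, ∀ v ∈ M, G.Reachable u v) (hM : M.Nonempty) {s : SteinerState G}
    (hs : SteinerReachable pos α M s) {T : G.Subgraph} (hT : s.IsOutput M T) :
    IsSteinerApprox pos α 2 M T := by
  refine ⟨hT.2.2, fun T' hT' => ?_⟩
  obtain ⟨F, -, -, hw⟩ := exists_completion hconn hM hT' hs
  have h1 := edgeSum_nonneg (pathEnergy_nonneg (pos := pos) (α := α) (G := G)) F
  have h2 : treeWeight pos α T ≤ treeWeight pos α s.marked := by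
    rw [treeWeight_eq_edgeSum, treeWeight_eq_edgeSum]
    exact edgeSum_mono edgeEnergy_nonneg fun x y h => hT.2.1.2 h
  linarith

end Approximation

end GroupComm

/-! ### The approximation ratio of the algorithm -/

theorem theorem4 {V : Type*} [Fintype V] (pos : V → Plane) (G : SimpleGraph V)
    (α εr : ℝ) (M : Finset V) (p : V → ℕ)
    (hα : 2 ≤ α)
    (hG : IsOmnidirectional pos G)
    (hεr : 0 ≤ εr)
    (hrx : ∀ u v : V, G.Adj u v → εr ≤ linkEnergy pos α u v)
    (hM : M.Nonempty)
    (hconn : ∀ u ∈ M, ∀ v ∈ M, G.Reachable u v) :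
    -- every execution of the algorithm stops, and only when all members are merged
    (¬ ∃ run : ℕ → SteinerState G, run 0 = SteinerState.init G M ∧
        ∀ n, SteinerStep pos α (run n) (run (n + 1))) ∧
    (∀ s : SteinerState G, SteinerReachable pos α M s →
        (¬ ∃ t, SteinerStep pos α s t) → s.IsFinal M ∧ ∃ T, s.IsOutput M T) ∧
    -- its result is a 2-approximate Steiner tree and a 145-approximation for MEAAM
    (∀ s : SteinerState G, SteinerReachable pos α M s → ∀ T : G.Subgraph, s.IsOutput M T →
        IsSteinerApprox pos α 2 M T ∧ IsMEAAMApprox pos α εr 145 M p T) ∧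
    -- more generally, so is every 2-approximate Steiner tree
    (∀ T : G.Subgraph, IsSteinerApprox pos α 2 M T → IsMEAAMApprox pos α εr 145 M p T) := by
  refine ⟨fun ⟨run, _, hrun⟩ => not_exists_infinite_run run hrun, fun s hs hhalt => ?_,
    fun s hs T hT => ?_, fun T hT => hT.isMEAAMApprox hG hα hεr hrx p⟩
  · have hfin := isFinal_of_not_step hs.valid hconn hM hhalt
    exact ⟨hfin, exists_output hs.valid hM hfin⟩
  · have hsteiner := hT.isSteinerApprox hconn hM hs
    exact ⟨hsteiner, hsteiner.isMEAAMApprox hG hα hεr hrx p⟩
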